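/- **Setting.** Let $G=(V,E)$ be a finite directed graph ($E\subseteq V\times V$, self-loops allowed), $v.post=\{w\mid (v,w)\in E\}$ and $v.pre=\{w\mid (w,v)\in E\}$. Each vertex $v$ has, in shared memory, a status $v.status\in\{\mathtt{LIVE},\mathtt{DEAD}\}$ and an integer counter $v.deg_{out}$. Let $\mathcal P\ge 1$ be the number of workers; each worker $p$ has a private waiting set $Q_p$, which is empty when the worker is started. The parallel AC-4-based trimming algorithm is: 1. for every $v\in V$: $v.status,\ v.deg_{out}:=\mathtt{LIVE},\ |v.post|$; 2. partition $V$ into pairwise disjoint (possibly empty) blocks $V_1,\dots,V_{\mathcal P}$; 3. run $\mathrm{Trim}_1(V_1)\parallel\dots\parallel \mathrm{Trim}_{\mathcal P}(V_{\mathcal P})$ and wait for all of them. $\mathrm{Trim}_p(V_p)$: for every $v\in V_p$ that is $\mathtt{LIVE}$ when visited, set $Q_p:=\emptyset$, call $\mathrm{DoDegree}_p(v)$, and then, while $Q_p\ne\emptyset$, remove a vertex $w$ from $Q_p$ and for every $v'\in w.pre$ execute $\mathrm{FAA}(v'.deg_{out},-1)$ followed by $\mathrm{DoDegree}_p(v')$.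 $\mathrm{DoDegree}_p(v)$: if $v.deg_{out}=0$ and then $\mathrm{CAS}(v.status,\mathtt{LIVE},\mathtt{DEAD})$ returns true, set $Q_p:=Q_p\cup\{v\}$. Here $\mathrm{FAA}(x,a)$ atomically replaces $x$ by $x+a$; $\mathrm{CAS}(x,a,b)$ atomically tests $x=a$, sets $x:=b$ and returns true if so, and returns false without changing $x$ otherwise. The workers run concurrently: an execution is an arbitrary interleaving of atomic steps of the workers, each of which accesses at most one shared variable (reading a status, reading a counter, one FAA, or one CAS). The memory contents before line 1, the partition, the order in which loops visit their elements, and the choice of $w\in Q_p$ are arbitrary. Define $$sound(V)\equiv\forall v\in V:\ v.status=\mathtt{DEAD}\Rightarrow(\forall w\in v.post:\ w.status=\mathtt{DEAD}),$$ $$complete(V)\equiv\forall v\in V:\ (\forall w\in v.post:\ w.status=\mathtt{DEAD})\Rightarrow v.status=\mathtt{DEAD}.$$ **Theorem (Soundness and Completeness).** For every finite directed graph $G=(V,E)$ and every $\mathcal P\ge 1$, the algorithm terminates with $sound(V)\wedge complete(V)$. That is, no execution is infinite; no execution gets stuck: a configuration reached by an execution has no further step if and only if the program has terminated (all workers have finished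 and have been joined); and whenever the program has terminated, $sound(V)$ and $complete(V)$ hold. Moreover, in every terminated execution, each vertex that is $\mathtt{DEAD}$ at the end has entered exactly one of the private waiting sets $Q_1,\dots,Q_{\mathcal P}$, and has done so exactly once. -/

import Mathlib

namespace AC4

/-! ### Graphs -/

section Graphs

variable {V : Type*}

/-- The transposed graph: the same vertices, all edges reversed. -/
def transpose (G : Digraph V) : Digraph V := ⟨fun v w => G.Adj w v⟩

open Classical in
/-- `post G v` is the finite set of successors of `v` in `G`. -/
noncomputable def post [Fintype V] (G : Digraph V) (v : V) : Finset V :=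
  Finset.univ.filter (fun w => G.Adj v w)

end Graphs

/-! ### Shared memory and atomic primitives -/

/-- The status of a vertex. -/
inductive Status where
  | LIVE
  | DEAD
  deriving DecidableEq

/-- The shared memory: for every vertex its status and its out-degree counter. -/
structure Memory (V : Type*) where
  status : V → Status
  deg : V → ℤ

/-- Compare-and-swap on a cell with contents `x`: the returned Boolean and the new contents. -/
def cas {α : Type*} [DecidableEq α] (x a b : α) : Bool × α :=
  if x = a then (true, b) else (false, x)

/-- Fetch-and-add on a cell with contents `x`: the new contents. -/
def faa (x a : ℤ) : ℤ := x + a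

section Algorithm

variable {V : Type*}

/-- Every removed vertex has only removed successors. -/
def sound [Fintype V] (G : Digraph V) (m : Memory V) : Prop :=
  ∀ v : V, m.status v = Status.DEAD → ∀ w ∈ post G v, m.status w = Status.DEAD

/-- Every vertex that has only removed successors is removed. -/
def complete [Fintype V] (G : Digraph V) (m : Memory V) : Prop :=
  ∀ v : V, (∀ w ∈ post G v, m.status w = Status.DEAD) → m.status v = Status.DEAD

/-! ### The program of one worker

```
procedure Trim_p(V_p)
  for v in V_p with v.status = LIVE
    Q_p := {}; DoDegree_p(v, Q_p)
    while Q_p is non-empty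
      remove a vertex w from Q_p
      for v' in w(G^T).post
        FAA(v'.deg, -1)
        DoDegree_p(v', Q_p)

procedure DoDegree_p(v, Q_p)
  if v.deg = 0 and CAS(v.status, LIVE, DEAD)
    Q_p := Q_p with v added
```
-/

/-- Where a call of `DoDegree` returns to: the while-loop (after the call in the outer for-loop),
or the inner for-loop with the given predecessors still to be visited. -/
inductive Return (V : Type*) where
  | toWhile
  | toPreds (rem : Finset V)

/-- Program counters of a worker. -/
inductive PC (V : Type*) where
  /-- head of the outer for-loop -/
  | forHead
  /-- about to execute `Q_p := {}` in the body of the outer for-loop for `v` -/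
  | reset (v : V)
  /-- head of the while-loop -/
  | whileHead
  /-- head of the inner for-loop, the vertices in `rem` are still to be visited -/
  | preds (rem : Finset V)
  /-- in `DoDegree` for `v`: about to read the counter of `v` -/
  | readDeg (v : V) (ret : Return V)
  /-- in `DoDegree` for `v`: about to execute the compare-and-swap on the status of `v` -/
  | tryCas (v : V) (ret : Return V)
  /-- in `DoDegree` for `v`: about to add `v` to the waiting set -/
  | enqueue (v : V) (ret : Return V)
  /-- the worker has finished -/
  | halted

/-- The program counter at which execution continues after `DoDegree`. -/
def Return.pc : Return V → PC V
  | .toWhile => .whileHead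
  | .toPreds rem => .preds rem

/-- The private state of a worker: the vertices of `V_p` that the outer for-loop has not visited
yet, the waiting set `Q_p`, and the program counter. -/
structure Worker (V : Type*) where
  todo : Finset V
  Q : Finset V
  pc : PC V

/-- The state in which a worker starts on its block `V_p`. -/
def Worker.start (Vp : Finset V) : Worker V := ⟨Vp, ∅, .forHead⟩

variable [Fintype V] [DecidableEq V]

/-- `WorkerStep G m s m' s'`: a worker in state `s` can take one atomic step that leads to
state `s'` and changes the shared memory from `m` to `m'`. Each step accesses at most one cell of
the shared memory. For-loops visit their elements in any order. -/
inductive WorkerStep (G : Digraph V) :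
    Memory V → Worker V → Memory V → Worker V → Prop
  | visitLive (m : Memory V) (todo Q : Finset V) (v : V) (hv : v ∈ todo)
      (hs : m.status v = Status.LIVE) :
      WorkerStep G m ⟨todo, Q, .forHead⟩ m ⟨todo.erase v, Q, .reset v⟩
  | visitDead (m : Memory V) (todo Q : Finset V) (v : V) (hv : v ∈ todo)
      (hs : m.status v ≠ Status.LIVE) :
      WorkerStep G m ⟨todo, Q, .forHead⟩ m ⟨todo.erase v, Q, .forHead⟩
  | finish (m : Memory V) (Q : Finset V) :
      WorkerStep G m ⟨∅, Q, .forHead⟩ m ⟨∅, Q, .halted⟩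
  | reset (m : Memory V) (todo Q : Finset V) (v : V) :
      WorkerStep G m ⟨todo, Q, .reset v⟩ m ⟨todo, ∅, .readDeg v .toWhile⟩
  | remove (m : Memory V) (todo Q : Finset V) (w : V) (hw : w ∈ Q) :
      WorkerStep G m ⟨todo, Q, .whileHead⟩
        m ⟨todo, Q.erase w, .preds (post (transpose G) w)⟩
  | whileExit (m : Memory V) (todo : Finset V) :
      WorkerStep G m ⟨todo, ∅, .whileHead⟩ m ⟨todo, ∅, .forHead⟩
  | decrement (m : Memory V) (todo Q rem : Finset V) (v : V) (hv : v ∈ rem) :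
      WorkerStep G m ⟨todo, Q, .preds rem⟩
        { m with deg := Function.update m.deg v (faa (m.deg v) (-1)) }
        ⟨todo, Q, .readDeg v (.toPreds (rem.erase v))⟩
  | predsExit (m : Memory V) (todo Q : Finset V) :
      WorkerStep G m ⟨todo, Q, .preds ∅⟩ m ⟨todo, Q, .whileHead⟩
  | degZero (m : Memory V) (todo Q : Finset V) (v : V) (ret : Return V)
      (hd : m.deg v = 0) :
      WorkerStep G m ⟨todo, Q, .readDeg v ret⟩ m ⟨todo, Q, .tryCas v ret⟩
  | degNonzero (m : Memory V) (todo Q : Finset V) (v : V) (ret : Return V)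
      (hd : m.deg v ≠ 0) :
      WorkerStep G m ⟨todo, Q, .readDeg v ret⟩ m ⟨todo, Q, ret.pc⟩
  | tryCas (m : Memory V) (todo Q : Finset V) (v : V) (ret : Return V) :
      WorkerStep G m ⟨todo, Q, .tryCas v ret⟩
        { m with status :=
            Function.update m.status v (cas (m.status v) Status.LIVE Status.DEAD).2 }
        ⟨todo, Q, if (cas (m.status v) Status.LIVE Status.DEAD).1 then .enqueue v ret
          else ret.pc⟩
  | enqueue (m : Memory V) (todo Q : Finset V) (v : V) (ret : Return V) :
      WorkerStep G m ⟨todo, Q, .enqueue v ret⟩ m ⟨todo, insert v Q, ret.pc⟩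

/-! ### The whole program

```
for v in V: v.status, v.deg := LIVE, |v.post|
partition V into V_1, ..., V_P
Trim_1(V_1) || ... || Trim_P(V_P)
```
-/

/-- The control state of the whole program with `P` workers. -/
inductive Control (V : Type*) (P : ℕ) where
  /-- the initial for-loop, the vertices in `rem` are still to be visited -/
  | init (rem : Finset V)
  /-- about to partition the vertices and to fork the workers -/
  | fork
  /-- the workers run in parallel -/
  | parallel (L : Fin P → Worker V)
  /-- all workers have been joined, the program has terminated -/
  | done

/-- A configuration: the shared memory and the control state. -/
structure Config (V : Type*) (P : ℕ) where
  mem : Memory V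
  control : Control V P

/-- The program starts at its first line, with arbitrary contents of the memory. -/
def Config.IsInitial {P : ℕ} (c : Config V P) : Prop :=
  c.control = .init Finset.univ

/-- The program has terminated. -/
def Config.Terminated {V : Type*} {P : ℕ} (c : Config V P) : Prop := c.control = .done

/-- The contents of the private waiting set of worker `p` (empty while no workers exist). -/
def Config.waiting {V : Type*} {P : ℕ} (c : Config V P) (p : Fin P) : Finset V :=
  match c.control with
  | .parallel L => (L p).Q
  | _ => ∅

/-- `Step G c c'`: the program can go from `c` to `c'` in one step. In the parallel phase an
arbitrary worker takes one atomic step. -/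
inductive Step {P : ℕ} (G : Digraph V) : Config V P → Config V P → Prop
  | initVertex (m : Memory V) (rem : Finset V) (v : V) (hv : v ∈ rem) :
      Step G ⟨m, .init rem⟩
        ⟨⟨Function.update m.status v Status.LIVE,
          Function.update m.deg v ((post G v).card : ℤ)⟩, .init (rem.erase v)⟩
  | initExit (m : Memory V) : Step G ⟨m, .init ∅⟩ ⟨m, .fork⟩
  | fork (m : Memory V) (part : Fin P → Finset V) (hpart : ∀ v : V, ∃! p, v ∈ part p) :
      Step G ⟨m, .fork⟩ ⟨m, .parallel (fun p => Worker.start (part p))⟩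
  | worker (m m' : Memory V) (L : Fin P → Worker V) (p : Fin P) (s' : Worker V)
      (hstep : WorkerStep G m (L p) m' s') :
      Step G ⟨m, .parallel L⟩ ⟨m', .parallel (Function.update L p s')⟩
  | join (m : Memory V) (L : Fin P → Worker V) (hL : ∀ p, (L p).pc = .halted) :
      Step G ⟨m, .parallel L⟩ ⟨m, .done⟩

/-- `IsExecution G c N`: the configurations `c 0, ..., c N` form an execution of `N` steps that
starts in an initial configuration. -/
def IsExecution {P : ℕ} (G : Digraph V) (c : ℕ → Config V P) (N : ℕ) : Prop :=
  (c 0).IsInitial ∧ ∀ i < N, Step G (c i) (c (i + 1))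

/-- In the step from `c` to `c'`, the vertex `v` enters the waiting set of worker `p`. -/
def Enters {V : Type*} {P : ℕ} (c c' : Config V P) (v : V) (p : Fin P) : Prop :=
  v ∉ c.waiting p ∧ v ∈ c'.waiting p

end Algorithm

end AC4

/-!
The counter of a vertex `u` is always the number of its successors whose removal has not yet been
reported to `u`. Such a successor is either live, or dead and on its way through some worker:
about to be put into the waiting set, lying in the waiting set, or being the vertex whose
predecessors are currently visited, with `u` still among those to come. `Worker.pending` counts
the reports to `u` that a worker still owes, and the central conservation law is
`deg u = #(live successors of u) + ∑ p, pending p u` (`WorkerStep.balance`). Three consequences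
drive the proof.

* Counters are never negative and never increase, so a counter that has reached zero stays zero.
  A vertex is only killed after its counter was read as zero, hence dead vertices have counter
  zero. When all workers have halted nothing is pending, so the counter is the number of live
  successors: this is soundness.
* A live vertex with counter zero is always still going to be examined by some worker
  (`Worker.Responsible`): initially it lies in a block of the partition, and whoever decrements a
  counter to zero examines it next. Halted workers examine nothing, which gives completeness.
* The compare-and-swap succeeds once per vertex, so the number of times a vertex has entered a
  waiting set, plus the number of workers about to insert it, is one if the vertex is dead and
  zero otherwise (`WorkerStep.entry_balance`). The number of past entries is not part of a
  configuration, so the invariant `Invariant` carries it as a parameter.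

Termination needs no invariant: `Config.rank` is a natural number which every step decreases. A
live vertex weighs more than a queued one, which in turn weighs more than a visit to all of its
predecessors.
-/

namespace AC4

section Proof

variable {V : Type*}

/-! ### Successors, statuses and finite sums -/

theorem mem_post [Fintype V] {G : Digraph V} {v w : V} : w ∈ post G v ↔ G.Adj v w := by
  simp [post]

theorem mem_post_transpose [Fintype V] {G : Digraph V} {v w : V} :
    w ∈ post (transpose G) v ↔ v ∈ post G w := by
  rw [mem_post, mem_post, transpose]

theorem Status.ne_live_iff {s : Status} : s ≠ .LIVE ↔ s = .DEAD := by
  cases s <;> simp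

theorem Status.ne_dead_iff {s : Status} : s ≠ .DEAD ↔ s = .LIVE := by
  cases s <;> simp

theorem Return.pc_ne_tryCas {ret ret' : Return V} {v : V} : ret.pc ≠ .tryCas v ret' := by
  cases ret <;> simp [Return.pc]

theorem Return.pc_ne_enqueue {ret ret' : Return V} {v : V} : ret.pc ≠ .enqueue v ret' := by
  cases ret <;> simp [Return.pc]

/-- Replacing one entry of a finite family exchanges the corresponding summand. -/
theorem sum_update_add {ι α : Type*} [Fintype ι] [DecidableEq ι] (L : ι → α) (p : ι) (s : α)
    (f : α → ℕ) :
    ∑ q, f (Function.update L p s q) + f (L p) = ∑ q, f (L q) + f s := by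
  rw [← Finset.add_sum_erase _ (fun q => f (Function.update L p s q)) (Finset.mem_univ p),
    ← Finset.add_sum_erase _ (fun q => f (L q)) (Finset.mem_univ p)]
  have : ∑ q ∈ Finset.univ.erase p, f (Function.update L p s q)
      = ∑ q ∈ Finset.univ.erase p, f (L q) :=
    Finset.sum_congr rfl fun q hq => by
      rw [Function.update_of_ne (Finset.ne_of_mem_erase hq)]
  simp only [Function.update_self, this]
  omega

/-! ### Entries into waiting sets -/

open Classical in
/-- The number of waiting sets that `v` enters in the step from `c` to `c'`. -/
noncomputable def entries {P : ℕ} (c c' : Config V P) (v : V) : ℕ :=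
  ∑ p : Fin P, if Enters c c' v p then 1 else 0

open Classical in
theorem entries_worker [DecidableEq V] {P : ℕ} (m m' : Memory V) (L : Fin P → Worker V) (p : Fin P)
    (s' : Worker V) (v : V) :
    entries ⟨m, .parallel L⟩ ⟨m', .parallel (Function.update L p s')⟩ v
      = if v ∉ (L p).Q ∧ v ∈ s'.Q then 1 else 0 := by
  unfold entries
  rw [Finset.sum_eq_single p]
  · simp [Enters, Config.waiting]
  · intro q _ hqp
    simp [Enters, Config.waiting, hqp]
  · simp

theorem existsUnique_enters {P : ℕ} (c : ℕ → Config V P) (N : ℕ) (v : V)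
    (h : ∑ i ∈ Finset.range N, entries (c i) (c (i + 1)) v = 1) :
    ∃! e : ℕ × Fin P, e.1 < N ∧ Enters (c e.1) (c (e.1 + 1)) v e.2 := by
  classical
  unfold entries at h
  rw [← Finset.sum_product' (f := fun i p => if Enters (c i) (c (i + 1)) v p then 1 else 0),
    ← Finset.card_filter, Finset.card_eq_one] at h
  obtain ⟨e, he⟩ := h
  have hmem : ∀ x : ℕ × Fin P, x.1 < N ∧ Enters (c x.1) (c (x.1 + 1)) v x.2 ↔ x = e := by
    intro x
    simpa using Finset.ext_iff.mp he x
  exact ⟨e, (hmem e).mpr rfl, fun x hx => (hmem x).mp hx⟩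

/-! ### Termination -/

/-- The rank of the program counter to which a call of `DoDegree` returns. -/
def Return.rank : Return V → ℕ
  | .toWhile => 2
  | .toPreds rem => 3 + 4 * rem.card

variable [Fintype V]

/-- The weight of a program counter in the termination measure. The summand `4 * card V + 2` at
`enqueue` is the weight of the vertex that is about to join the waiting set. -/
def PC.rank : PC V → ℕ
  | .halted => 0
  | .forHead => 1
  | .whileHead => 2
  | .preds rem => 3 + 4 * rem.card
  | .reset _ => 5
  | .readDeg _ ret => ret.rank + 2
  | .tryCas _ ret => ret.rank + 1
  | .enqueue _ ret => ret.rank + (4 * Fintype.card V + 2) + 1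

theorem Return.rank_pc (ret : Return V) : ret.pc.rank = ret.rank := by
  cases ret <;> rfl

/-- The weight of a worker: its program counter, `5` for each vertex of the block that is still to
be visited, and `4 * card V + 2` for each vertex in the waiting set. The latter is chosen so that
removing a vertex pays for entering the inner for-loop, whose weight is at most
`3 + 4 * card V`, from the head of the while-loop, whose weight is `2`. -/
def Worker.rank (s : Worker V) : ℕ :=
  s.pc.rank + 5 * s.todo.card + (4 * Fintype.card V + 2) * s.Q.card

open Classical in
/-- The number of live vertices. -/
noncomputable def Memory.liveCount (m : Memory V) : ℕ :=
  (Finset.univ.filter fun v => m.status v = .LIVE).card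

/-- A bound for the remaining number of steps of the whole program. In the parallel phase a live
vertex weighs `4 * card V + 3`, one more than a vertex in a waiting set; before that phase, all
vertices are counted as live and every block as all of `V`. -/
noncomputable def Config.rank {P : ℕ} (c : Config V P) : ℕ :=
  match c.control with
  | .init rem => (4 * Fintype.card V + 3) * Fintype.card V + P * (5 * Fintype.card V + 1) + 3
      + rem.card
  | .fork => (4 * Fintype.card V + 3) * Fintype.card V + P * (5 * Fintype.card V + 1) + 2
  | .parallel L => (4 * Fintype.card V + 3) * c.mem.liveCount + ∑ p, (L p).rank + 1
  | .done => 0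

variable [DecidableEq V]

theorem Memory.liveCount_kill (m : Memory V) {v : V} (hv : m.status v = .LIVE) :
    ({ m with status := Function.update m.status v .DEAD } : Memory V).liveCount + 1
      = m.liveCount := by
  classical
  unfold liveCount
  rw [← Finset.card_erase_add_one (s := Finset.univ.filter fun v => m.status v = .LIVE) (a := v)
    (by simpa using hv)]
  congr 2
  ext w
  by_cases h : w = v <;> simp [h]

theorem WorkerStep.rank_lt {G : Digraph V} {m m' : Memory V} {s s' : Worker V}
    (h : WorkerStep G m s m' s') :
    (4 * Fintype.card V + 3) * m'.liveCount + s'.rank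
      < (4 * Fintype.card V + 3) * m.liveCount + s.rank := by
  cases h with
  | visitLive todo Q v hv hs | visitDead todo Q v hv hs =>
    have := Finset.card_erase_add_one hv
    simp only [Worker.rank, PC.rank]
    omega
  | finish Q => simp [Worker.rank, PC.rank]
  | reset todo Q v =>
    simp only [Worker.rank, PC.rank, Return.rank, Finset.card_empty]
    omega
  | remove todo Q w hw =>
    have := Finset.card_erase_add_one hw
    have hle := Finset.card_le_univ (post (transpose G) w)
    simp only [Worker.rank, PC.rank, ← this, mul_add]
    omega
  | whileExit todo => simp [Worker.rank, PC.rank]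
  | decrement todo Q rem v hv =>
    have := Finset.card_erase_add_one hv
    simp only [Worker.rank, PC.rank, Return.rank, Memory.liveCount]
    omega
  | predsExit todo Q => simp [Worker.rank, PC.rank]
  | degZero todo Q v ret hd => simp [Worker.rank, PC.rank]
  | degNonzero todo Q v ret hd =>
    simp only [Worker.rank, Return.rank_pc]
    simp only [PC.rank]
    omega
  | tryCas todo Q v ret =>
    by_cases hv : m.status v = .LIVE
    · have := m.liveCount_kill hv
      simp only [cas, hv, if_true, Worker.rank, PC.rank, ← this, mul_add]
      omega
    · simp only [cas, hv, if_false, Function.update_eq_self, Worker.rank, Return.rank_pc,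
        Bool.false_eq_true]
      simp only [PC.rank]
      exact Nat.add_lt_add_left (by omega) _
  | enqueue todo Q v ret =>
    have := Nat.mul_le_mul_left (4 * Fintype.card V + 2) (Finset.card_insert_le v Q)
    simp only [mul_add] at this
    simp only [Worker.rank, Return.rank_pc]
    simp only [PC.rank]
    omega

theorem Step.rank_lt {P : ℕ} {G : Digraph V} {c c' : Config V P} (h : Step G c c') :
    c'.rank < c.rank := by
  classical
  cases h with
  | initVertex m rem v hv =>
    have := Finset.card_erase_add_one hv
    simp only [Config.rank]
    omega
  | initExit m => simp [Config.rank]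
  | fork m part hpart =>
    have h1 : (4 * Fintype.card V + 3) * m.liveCount
        ≤ (4 * Fintype.card V + 3) * Fintype.card V :=
      Nat.mul_le_mul_left _ (Finset.card_le_univ _)
    have h2 : ∑ p, (Worker.start (part p)).rank ≤ P * (5 * Fintype.card V + 1) := by
      refine (Finset.sum_le_card_nsmul _ _ (5 * Fintype.card V + 1) fun p _ => ?_).trans_eq
        (by simp)
      have := Finset.card_le_univ (part p)
      simp only [Worker.rank, Worker.start, PC.rank, Finset.card_empty]
      omega
    simp only [Config.rank]
    omega
  | worker m m' L p s' hstep =>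
    have h1 := sum_update_add L p s' Worker.rank
    have h2 := hstep.rank_lt
    simp only [Config.rank]
    omega
  | join m L hL => simp [Config.rank]

theorem not_exists_infinite_execution (G : Digraph V) (P : ℕ) :
    ¬ ∃ c : ℕ → Config V P, ∀ N, IsExecution G c N := by
  rintro ⟨c, hc⟩
  have key : ∀ n, (c n).rank + n ≤ (c 0).rank := by
    intro n
    induction n with
    | zero => simp
    | succ n ih =>
      have := ((hc (n + 1)).2 n n.lt_succ_self).rank_lt
      omega
  have := key ((c 0).rank + 1)
  omega

/-! ### Progress -/

theorem WorkerStep.exists_of_ne_halted (G : Digraph V) (m : Memory V) (s : Worker V)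
    (hs : s.pc ≠ .halted) : ∃ m' s', WorkerStep G m s m' s' := by
  obtain ⟨todo, Q, pc⟩ := s
  cases pc with
  | forHead =>
    obtain rfl | ⟨v, hv⟩ := todo.eq_empty_or_nonempty
    · exact ⟨_, _, .finish m Q⟩
    · by_cases hl : m.status v = .LIVE
      · exact ⟨_, _, .visitLive m todo Q v hv hl⟩
      · exact ⟨_, _, .visitDead m todo Q v hv hl⟩
  | reset v => exact ⟨_, _, .reset m todo Q v⟩
  | whileHead =>
    obtain rfl | ⟨w, hw⟩ := Q.eq_empty_or_nonempty
    · exact ⟨_, _, .whileExit m todo⟩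
    · exact ⟨_, _, .remove m todo Q w hw⟩
  | preds rem =>
    obtain rfl | ⟨v, hv⟩ := rem.eq_empty_or_nonempty
    · exact ⟨_, _, .predsExit m todo Q⟩
    · exact ⟨_, _, .decrement m todo Q rem v hv⟩
  | readDeg v ret =>
    by_cases hd : m.deg v = 0
    · exact ⟨_, _, .degZero m todo Q v ret hd⟩
    · exact ⟨_, _, .degNonzero m todo Q v ret hd⟩
  | tryCas v ret => exact ⟨_, _, .tryCas m todo Q v ret⟩
  | enqueue v ret => exact ⟨_, _, .enqueue m todo Q v ret⟩
  | halted => exact absurd rfl hs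

theorem stuck_iff_terminated {P : ℕ} (hP : 0 < P) (G : Digraph V) (c : Config V P) :
    (¬ ∃ c', Step G c c') ↔ c.Terminated := by
  constructor
  · intro hstuck
    by_contra hdone
    apply hstuck
    obtain ⟨m, ctl⟩ := c
    cases ctl with
    | init rem =>
      obtain rfl | ⟨v, hv⟩ := rem.eq_empty_or_nonempty
      · exact ⟨_, .initExit m⟩
      · exact ⟨_, .initVertex m rem v hv⟩
    | fork =>
      -- A partition exists because there is a worker that can take all of `V`.
      refine ⟨_, .fork m (fun p => if p = ⟨0, hP⟩ then Finset.univ else ∅) fun v =>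
        ⟨⟨0, hP⟩, by simp, fun p hp => ?_⟩⟩
      by_contra hne
      simp [hne] at hp
    | parallel L =>
      by_cases hL : ∀ p, (L p).pc = .halted
      · exact ⟨_, .join m L hL⟩
      · obtain ⟨p, hp⟩ := not_forall.mp hL
        obtain ⟨m', s', h⟩ := WorkerStep.exists_of_ne_halted G m (L p) hp
        exact ⟨_, .worker m m' L p s' h⟩
    | done => exact (hdone rfl).elim
  · rintro hdone ⟨c', hstep⟩
    cases hstep <;> cases hdone

/-! ### What a worker owes -/

/-- The number of reports to `u` that are still owed after returning from `DoDegree`. -/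
def Return.pending (u : V) : Return V → ℕ
  | .toWhile => 0
  | .toPreds rem => if u ∈ rem then 1 else 0

/-- The number of reports to `u` that are owed according to the program counter. -/
noncomputable def PC.pending (G : Digraph V) (u : V) : PC V → ℕ
  | .preds rem => if u ∈ rem then 1 else 0
  | .readDeg _ ret => ret.pending u
  | .tryCas _ ret => ret.pending u
  | .enqueue v ret => (if v ∈ post G u then 1 else 0) + ret.pending u
  | .forHead => 0
  | .reset _ => 0
  | .whileHead => 0
  | .halted => 0

/-- The number of dead successors of `u` that the worker has taken charge of but for which it has
not yet decremented the counter of `u`. -/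
noncomputable def Worker.pending (G : Digraph V) (u : V) (s : Worker V) : ℕ :=
  (s.Q.filter (· ∈ post G u)).card + s.pc.pending G u

/-- The number of live successors of `u`. -/
noncomputable def Memory.liveSucc (G : Digraph V) (m : Memory V) (u : V) : ℕ :=
  ((post G u).filter fun w => m.status w = .LIVE).card

/-- The worker is about to put `v` into its waiting set. -/
def Worker.Enqueues (s : Worker V) (v : V) : Prop := ∃ ret, s.pc = .enqueue v ret

/-- The worker is still going to examine `v`, or is just doing so. -/
def Worker.Responsible (s : Worker V) (v : V) : Prop :=
  v ∈ s.todo ∨ s.pc = .reset v ∨ (∃ ret, s.pc = .readDeg v ret) ∨ ∃ ret, s.pc = .tryCas v ret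

/-- Outside the while-loop the waiting set is empty, and the block of a halted worker has been
visited completely. -/
structure Worker.WellFormed (s : Worker V) : Prop where
  forHead : s.pc = .forHead → s.Q = ∅
  reset : ∀ v, s.pc = .reset v → s.Q = ∅
  halted : s.pc = .halted → s.Q = ∅ ∧ s.todo = ∅

theorem Return.pending_pc (G : Digraph V) (u : V) (ret : Return V) :
    ret.pc.pending G u = ret.pending u := by
  cases ret <;> rfl

theorem Memory.liveSucc_kill (G : Digraph V) (m : Memory V) (u : V) {v : V}
    (hv : m.status v = .LIVE) :
    ({ m with status := Function.update m.status v .DEAD } : Memory V).liveSucc G u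
      + (if v ∈ post G u then 1 else 0) = m.liveSucc G u := by
  have heq : (post G u).filter (fun w => Function.update m.status v .DEAD w = .LIVE)
      = ((post G u).filter fun w => m.status w = .LIVE).erase v := by
    ext w
    by_cases h : w = v <;> simp [h]
  unfold liveSucc
  simp only [heq]
  split_ifs with hmem
  · exact Finset.card_erase_add_one (by simp [hmem, hv])
  · rw [Finset.erase_eq_of_notMem (by simp [hmem]), add_zero]

/-! ### Effect of a single step of a worker -/

/-- Conservation law: a step changes the counter of `u` by as much as it changes the number of
live successors of `u` plus the number of reports to `u` owed by the worker. -/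
theorem WorkerStep.balance {G : Digraph V} {m m' : Memory V} {s s' : Worker V}
    (h : WorkerStep G m s m' s') (hwf : s.WellFormed) (hQ : ∀ v, s.Enqueues v → v ∉ s.Q) (u : V) :
    m'.deg u + m.liveSucc G u + s.pending G u = m.deg u + m'.liveSucc G u + s'.pending G u := by
  cases h with
  | visitLive todo Q v hv hs | visitDead todo Q v hv hs => rfl
  | finish Q => rfl
  | reset todo Q v =>
    obtain rfl : Q = ∅ := hwf.reset v rfl
    rfl
  | remove todo Q w hw =>
    simp only [Worker.pending, PC.pending, mem_post_transpose, Finset.filter_erase]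
    split_ifs with hmem
    · have := Finset.card_erase_add_one (s := Q.filter (· ∈ post G u)) (a := w)
        (by simp [hw, hmem])
      omega
    · rw [Finset.erase_eq_of_notMem (by simp [hmem])]
  | whileExit todo => rfl
  | decrement todo Q rem v hv =>
    by_cases hu : u = v
    · subst hu
      simp [Worker.pending, PC.pending, Return.pending, Memory.liveSucc, faa, hv]
      ring
    · simp [Worker.pending, PC.pending, Return.pending, Memory.liveSucc, hu]
  | predsExit todo Q => simp [Worker.pending, PC.pending]
  | degZero todo Q v ret hd => rfl
  | degNonzero todo Q v ret hd =>
    simp only [Worker.pending, Return.pending_pc]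
    simp only [PC.pending]
  | tryCas todo Q v ret =>
    by_cases hv : m.status v = .LIVE
    · have := m.liveSucc_kill G u hv
      simp only [cas, hv, if_true, Worker.pending, PC.pending, ← this]
      push_cast
      ring
    · simp only [cas, hv, if_false, Function.update_eq_self, Worker.pending, Return.pending_pc,
        Bool.false_eq_true]
      simp only [PC.pending]
  | enqueue todo Q v ret =>
    have hv : v ∉ Q := hQ v ⟨ret, rfl⟩
    simp only [Worker.pending, Return.pending_pc, Finset.filter_insert]
    simp only [PC.pending]
    split_ifs with hmem
    · rw [Finset.card_insert_of_notMem (by simp [hv])]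
      push_cast
      ring
    · simp

theorem WorkerStep.deg_le {G : Digraph V} {m m' : Memory V} {s s' : Worker V}
    (h : WorkerStep G m s m' s') (u : V) : m'.deg u ≤ m.deg u := by
  cases h with
  | decrement todo Q rem v hv =>
    by_cases hu : u = v
    · subst hu
      simp [faa]
    · simp [hu]
  | _ => exact le_rfl

theorem WorkerStep.dead_of_dead {G : Digraph V} {m m' : Memory V} {s s' : Worker V}
    (h : WorkerStep G m s m' s') {u : V} (hu : m.status u = .DEAD) : m'.status u = .DEAD := by
  cases h with
  | tryCas todo Q v ret =>
    by_cases huv : u = v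
    · subst huv
      simp [cas, hu]
    · simpa [huv] using hu
  | _ => exact hu

/-- Only the compare-and-swap kills a vertex. -/
theorem WorkerStep.dead_or_tryCas {G : Digraph V} {m m' : Memory V} {s s' : Worker V}
    (h : WorkerStep G m s m' s') {u : V} (hu : m'.status u = .DEAD) :
    m.status u = .DEAD ∨ ∃ ret, s.pc = .tryCas u ret := by
  cases h with
  | tryCas todo Q v ret =>
    by_cases huv : u = v
    · subst huv
      exact .inr ⟨ret, rfl⟩
    · exact .inl (by simpa [huv] using hu)
  | _ => exact .inl hu

/-- The compare-and-swap is only reached after the counter was read as zero. -/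
theorem WorkerStep.deg_eq_zero_of_tryCas {G : Digraph V} {m m' : Memory V} {s s' : Worker V}
    (h : WorkerStep G m s m' s') {v : V} {ret : Return V} (hs' : s'.pc = .tryCas v ret) :
    m'.deg v = 0 := by
  cases h with
  | degZero todo Q v ret hd =>
    cases hs'
    exact hd
  | degNonzero | enqueue => exact absurd hs' Return.pc_ne_tryCas
  | tryCas todo Q w ret =>
    dsimp only at hs'
    split_ifs at hs'
    exact absurd hs' Return.pc_ne_tryCas
  | _ => cases hs'

theorem WorkerStep.responsible {G : Digraph V} {m m' : Memory V} {s s' : Worker V}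
    (h : WorkerStep G m s m' s') {v : V} (hl : m'.status v = .LIVE) (hd : m'.deg v = 0)
    (hr : s.Responsible v) : s'.Responsible v := by
  unfold Worker.Responsible at *
  cases h with
  | visitLive todo Q w hw hs =>
    by_cases hvw : v = w
    · subst hvw
      simp
    · left
      simpa [hvw] using hr
  | visitDead todo Q w hw hs =>
    have hvw : v ≠ w := by
      rintro rfl
      exact hs hl
    left
    simpa [hvw] using hr
  | degNonzero todo Q w ret hd' =>
    rcases hr with hr | hr | ⟨_, hr⟩ | ⟨_, hr⟩
    · exact .inl hr
    · cases hr
    · cases hr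
      exact absurd hd hd'
    · cases hr
  | tryCas todo Q w ret =>
    rcases hr with hr | hr | ⟨_, hr⟩ | ⟨_, hr⟩
    · exact .inl hr
    · cases hr
    · cases hr
    · cases hr
      by_cases hw : m.status v = .LIVE <;> simp [cas, hw] at hl
  | _ => simp_all

/-- A worker that decrements a counter to zero examines the vertex next. -/
theorem WorkerStep.deg_eq_zero_or_responsible {G : Digraph V} {m m' : Memory V} {s s' : Worker V}
    (h : WorkerStep G m s m' s') {v : V} (hd : m'.deg v = 0) :
    m.deg v = 0 ∨ s'.Responsible v := by
  cases h with
  | decrement todo Q rem w hw =>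
    by_cases hvw : v = w
    · subst hvw
      exact .inr (.inr (.inr (.inl ⟨_, rfl⟩)))
    · exact .inl (by simpa [hvw] using hd)
  | _ => exact .inl hd

theorem WorkerStep.wellFormed {G : Digraph V} {m m' : Memory V} {s s' : Worker V}
    (h : WorkerStep G m s m' s') (hwf : s.WellFormed) : s'.WellFormed := by
  obtain ⟨h1, h2, h3⟩ := hwf
  cases h with
  | degNonzero todo Q w ret | enqueue todo Q w ret =>
    cases ret <;> constructor <;> simp [Return.pc]
  | tryCas todo Q w ret =>
    split_ifs
    · constructor <;> simp
    · cases ret <;> constructor <;> simp [Return.pc]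
  | _ => constructor <;> simp_all

open Classical in
/-- Each vertex that dies is inserted into a waiting set once: the number of entries of `v`, plus
the number of insertions of `v` about to be made, grows by one when `v` dies and is constant
otherwise. -/
theorem WorkerStep.entry_balance {G : Digraph V} {m m' : Memory V} {s s' : Worker V}
    (h : WorkerStep G m s m' s') (hQ : ∀ v, s.Enqueues v → v ∉ s.Q) (v : V) :
    (if v ∉ s.Q ∧ v ∈ s'.Q then 1 else 0) + (if s'.Enqueues v then 1 else 0)
        + (if m.status v = .DEAD then 1 else 0)
      = (if s.Enqueues v then 1 else 0) + (if m'.status v = .DEAD then 1 else 0) := by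
  cases h with
  | degNonzero todo Q w ret => simp [Worker.Enqueues, Return.pc_ne_enqueue]
  | tryCas todo Q w ret =>
    by_cases hw : m.status w = .LIVE
    · by_cases hvw : v = w
      · subst hvw
        simp [Worker.Enqueues, cas, hw]
      · simp [Worker.Enqueues, cas, hw, hvw, Ne.symm hvw]
    · simp [Worker.Enqueues, cas, hw, Return.pc_ne_enqueue]
  | enqueue todo Q w ret =>
    have hw : w ∉ Q := hQ w ⟨ret, rfl⟩
    by_cases hvw : v = w
    · subst hvw
      simp [Worker.Enqueues, Return.pc_ne_enqueue, hw]
    · simp [Worker.Enqueues, Return.pc_ne_enqueue, hvw, Ne.symm hvw]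
  | _ => simp +contextual [Worker.Enqueues]

/-! ### The global invariant -/

open Classical in
/-- The invariant of the parallel phase, where `h v` is the number of times that `v` has entered a
waiting set so far. -/
structure Invariant {P : ℕ} (G : Digraph V) (h : V → ℕ) (m : Memory V) (L : Fin P → Worker V) :
    Prop where
  wellFormed : ∀ p, (L p).WellFormed
  deg_eq : ∀ u, m.deg u = (m.liveSucc G u + ∑ p, (L p).pending G u : ℕ)
  deg_dead : ∀ u, m.status u = .DEAD → m.deg u = 0
  deg_tryCas : ∀ p v ret, (L p).pc = .tryCas v ret → m.deg v = 0
  responsible : ∀ v, m.status v = .LIVE → m.deg v = 0 → ∃ p, (L p).Responsible v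
  entries_add : ∀ v, h v + ∑ p, (if (L p).Enqueues v then 1 else 0)
    = if m.status v = .DEAD then 1 else 0
  entries_pos : ∀ p, ∀ v ∈ (L p).Q, 0 < h v

/-- A vertex about to be inserted has not entered any waiting set before. -/
theorem Invariant.notMem_of_enqueues {P : ℕ} {G : Digraph V} {h : V → ℕ} {m : Memory V}
    {L : Fin P → Worker V} (I : Invariant G h m L) (p : Fin P) (v : V) (hv : (L p).Enqueues v) :
    v ∉ (L p).Q := by
  classical
  intro hQ
  have h1 := I.entries_pos p v hQ
  have h2 := I.entries_add v
  have h3 := Finset.single_le_sum (f := fun p => if (L p).Enqueues v then 1 else 0)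
    (fun _ _ => Nat.zero_le _) (Finset.mem_univ p)
  simp only [hv, if_true] at h3
  split_ifs at h2 <;> omega

open Classical in
theorem Invariant.step {P : ℕ} {G : Digraph V} {h : V → ℕ} {m m' : Memory V}
    {L : Fin P → Worker V} (I : Invariant G h m L) {p : Fin P} {s' : Worker V}
    (hs : WorkerStep G m (L p) m' s') :
    Invariant G (fun v => h v + if v ∉ (L p).Q ∧ v ∈ s'.Q then 1 else 0) m'
      (Function.update L p s') := by
  have hQ := I.notMem_of_enqueues p
  have hdeg : ∀ u, m'.deg u
      = (m'.liveSucc G u + ∑ q, (Function.update L p s' q).pending G u : ℕ) := by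
    intro u
    have h1 := hs.balance (I.wellFormed p) hQ u
    have h2 := sum_update_add L p s' (Worker.pending G u)
    have h3 := I.deg_eq u
    omega
  have hzero : ∀ u, m.deg u = 0 → m'.deg u = 0 := by
    intro u hu
    have h1 := hs.deg_le u
    have h2 := hdeg u
    omega
  refine ⟨fun q => ?_, hdeg, fun u hu => ?_, fun q v ret hq => ?_, fun v hl hd => ?_,
    fun v => ?_, fun q v hv => ?_⟩
  · by_cases hqp : q = p
    · subst hqp
      simpa using hs.wellFormed (I.wellFormed q)
    · simpa [hqp] using I.wellFormed q
  · obtain h1 | ⟨ret, h1⟩ := hs.dead_or_tryCas hu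
    · exact hzero u (I.deg_dead u h1)
    · exact hzero u (I.deg_tryCas p u ret h1)
  · by_cases hqp : q = p
    · subst hqp
      exact hs.deg_eq_zero_of_tryCas (by simpa using hq)
    · exact hzero v (I.deg_tryCas q v ret (by simpa [hqp] using hq))
  · obtain h1 | h1 := hs.deg_eq_zero_or_responsible hd
    · have hl' : m.status v = .LIVE := by
        rw [← Status.ne_dead_iff]
        intro hdead
        simp [hs.dead_of_dead hdead] at hl
      obtain ⟨q, hq⟩ := I.responsible v hl' h1
      refine ⟨q, ?_⟩
      by_cases hqp : q = p
      · subst hqp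
        simpa using hs.responsible hl hd hq
      · simpa [hqp] using hq
    · exact ⟨p, by simpa using h1⟩
  · have h1 := hs.entry_balance hQ v
    have h2 := sum_update_add L p s' (fun s => if s.Enqueues v then 1 else 0)
    have h3 := I.entries_add v
    omega
  · by_cases hqp : q = p
    · subst hqp
      rw [Function.update_self] at hv
      by_cases hvQ : v ∈ (L q).Q
      · exact Nat.add_pos_left (I.entries_pos q v hvQ) _
      · simp [hvQ, hv]
    · rw [Function.update_of_ne hqp] at hv
      exact Nat.add_pos_left (I.entries_pos q v hv) _

theorem Invariant.fork {P : ℕ} (G : Digraph V) {m : Memory V}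
    (hm : ∀ v, m.status v = .LIVE ∧ m.deg v = ((post G v).card : ℤ))
    {part : Fin P → Finset V} (hpart : ∀ v : V, ∃! p, v ∈ part p) :
    Invariant G (fun _ => 0) m (fun p => Worker.start (part p)) := by
  refine ⟨fun p => ?_, fun u => ?_, fun u hu => ?_, fun p v ret hp => ?_, fun v _ _ => ?_,
    fun v => ?_, fun p v hv => ?_⟩
  · constructor <;> simp [Worker.start]
  · simp [Memory.liveSucc, hm, Worker.start, Worker.pending, PC.pending]
  · simp [hm] at hu
  · simp [Worker.start] at hp
  · obtain ⟨p, hp, -⟩ := hpart v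
    exact ⟨p, .inl hp⟩
  · simp [hm, Worker.Enqueues, Worker.start]
  · simp [Worker.start] at hv

section Final

variable {P : ℕ} {G : Digraph V} {h : V → ℕ} {m : Memory V} {L : Fin P → Worker V}

/-- Halted workers owe nothing, so a counter is zero exactly if all successors are dead. -/
theorem Invariant.deg_eq_zero_iff (I : Invariant G h m L) (hL : ∀ p, (L p).pc = .halted) (v : V) :
    m.deg v = 0 ↔ ∀ w ∈ post G v, m.status w = .DEAD := by
  have hpend : ∀ p, (L p).pending G v = 0 := fun p => by
    simp [Worker.pending, hL p, ((I.wellFormed p).halted (hL p)).1, PC.pending]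
  rw [I.deg_eq v]
  simp [hpend, Memory.liveSucc, Finset.filter_eq_empty_iff, ← Status.ne_live_iff]

theorem Invariant.sound (I : Invariant G h m L) (hL : ∀ p, (L p).pc = .halted) :
    sound G m :=
  fun v hv => (I.deg_eq_zero_iff hL v).mp (I.deg_dead v hv)

theorem Invariant.complete (I : Invariant G h m L) (hL : ∀ p, (L p).pc = .halted) :
    complete G m := by
  intro v hv
  rw [← Status.ne_live_iff]
  intro hl
  obtain ⟨p, hp⟩ := I.responsible v hl ((I.deg_eq_zero_iff hL v).mpr hv)
  simp [Worker.Responsible, hL p, ((I.wellFormed p).halted (hL p)).2] at hp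

theorem Invariant.entries_eq_one (I : Invariant G h m L) (hL : ∀ p, (L p).pc = .halted) {v : V}
    (hv : m.status v = .DEAD) : h v = 1 := by
  classical
  simpa [Worker.Enqueues, hL, hv] using I.entries_add v

end Final

/-! ### Executions -/

/-- The invariant of the whole program, where `h v` is the number of times that `v` has entered a
waiting set so far. -/
def Config.Invariant {P : ℕ} (G : Digraph V) (h : V → ℕ) (c : Config V P) : Prop :=
  match c.control with
  | .init rem => h = (fun _ => 0) ∧
      ∀ v ∉ rem, c.mem.status v = .LIVE ∧ c.mem.deg v = ((post G v).card : ℤ)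
  | .fork => h = (fun _ => 0) ∧
      ∀ v, c.mem.status v = .LIVE ∧ c.mem.deg v = ((post G v).card : ℤ)
  | .parallel L => AC4.Invariant G h c.mem L
  | .done => sound G c.mem ∧ complete G c.mem ∧ ∀ v, c.mem.status v = .DEAD → h v = 1

theorem Config.Invariant.step {P : ℕ} {G : Digraph V} {h : V → ℕ} {c c' : Config V P}
    (I : c.Invariant G h) (hs : Step G c c') :
    c'.Invariant G (fun v => h v + entries c c' v) := by
  classical
  cases hs with
  | initVertex m rem v hv =>
    obtain ⟨rfl, I⟩ := I
    refine ⟨by simp [entries, Enters, Config.waiting], fun w hw => ?_⟩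
    by_cases hwv : w = v
    · subst hwv
      simp
    · simpa [hwv] using I w fun hmem => hw (Finset.mem_erase.mpr ⟨hwv, hmem⟩)
  | initExit m =>
    obtain ⟨rfl, I⟩ := I
    exact ⟨by simp [entries, Enters, Config.waiting], fun w => I w (Finset.notMem_empty w)⟩
  | fork m part hpart =>
    obtain ⟨rfl, I⟩ := I
    have := AC4.Invariant.fork G I hpart
    simpa [Config.Invariant, entries, Enters, Config.waiting, Worker.start] using this
  | worker m m' L p s' hstep =>
    simp only [entries_worker]
    exact AC4.Invariant.step I hstep
  | join m L hL =>
    have hI : AC4.Invariant G h m L := I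
    refine ⟨hI.sound hL, hI.complete hL, fun v hv => ?_⟩
    simp [entries, Enters, Config.waiting, hI.entries_eq_one hL hv]

theorem IsExecution.invariant {P : ℕ} {G : Digraph V} {c : ℕ → Config V P} {N : ℕ}
    (hc : IsExecution G c N) :
    (c N).Invariant G (fun v => ∑ i ∈ Finset.range N, entries (c i) (c (i + 1)) v) := by
  induction N with
  | zero =>
    have h0 : (c 0).control = .init Finset.univ := hc.1
    simp [Config.Invariant, h0]
  | succ N ih =>
    simp only [Finset.sum_range_succ]
    exact (ih ⟨hc.1, fun i hi => hc.2 i (by omega)⟩).step (hc.2 N N.lt_succ_self)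

end Proof

end AC4

/-- Every schedule of the parallel AC-4-based trimming algorithm is finite; it cannot get stuck
before the program has terminated; on termination the statuses are sound and complete, and every
dead vertex has entered exactly one private waiting set, exactly once. -/
theorem mainTheorem8 {V : Type*} [Fintype V] [DecidableEq V] (G : Digraph V)
    (P : ℕ) (hP : 0 < P) :
    (¬ ∃ c : ℕ → AC4.Config V P, ∀ N, AC4.IsExecution G c N) ∧
    ∀ (c : ℕ → AC4.Config V P) (N : ℕ), AC4.IsExecution G c N →
      ((¬ ∃ c', AC4.Step G (c N) c') ↔ (c N).Terminated) ∧
      ((c N).Terminated →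
        AC4.sound G (c N).mem ∧ AC4.complete G (c N).mem ∧
        ∀ v : V, (c N).mem.status v = AC4.Status.DEAD →
          ∃! e : ℕ × Fin P, e.1 < N ∧ AC4.Enters (c e.1) (c (e.1 + 1)) v e.2) := by
  refine ⟨AC4.not_exists_infinite_execution G P, fun c N hc =>
    ⟨AC4.stuck_iff_terminated hP G (c N), fun hdone => ?_⟩⟩
  have I := hc.invariant
  have hctl : (c N).control = .done := hdone
  simp only [AC4.Config.Invariant, hctl] at I
  exact ⟨I.1, I.2.1, fun v hv => AC4.existsUnique_enters c N v (I.2.2 v hv)⟩
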